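/- All binary trees below are finite, rooted and plane, with nodes labeled by positive integers; $\ell(v)$ is the label of $v$, $\max(T)$ is the largest label ($0$ for the empty tree), and $v_1,\dots,v_n$ are the nodes of $T$ in in-order. A \emph{Fishburn tree} is such a tree $T$ of size $n\ge 0$ such that: each node $r$ with left and right subtrees $L,R$ satisfies $\ell(r)>\max(L)$ and $\ell(r)\ge\max(R)$; the set of labels is $\{1,\dots,k\}$ for some $k\le n$; and the set of nodes $v_j$ with $\ell(v_i)\ne\ell(v_j)$ for all $i<j$ equals the set consisting of $v_1$ and all nodes that have a left child. The \emph{diagonal} of $T$ is the maximal left path starting at the root. Each node $u$ lies on a unique maximal right path; let $w$ be the first node of that path, and put $b(u)=\ell(w)$ if $w$ is on the diagonal, and $b(u)=\ell(p)$, where $p$ is the parent of $w$, otherwise. Associate with $T$: - the modified ascent sequence $x=\ell(v_1)\cdots\ell(v_n)$; - the Fishburn matrix $A=(a_{i,j})_{1\le i,j\le k}$, $k=\max(T)$, where $a_{i,j}$ is the number of nodes $u$ with $b(u)=i$ and $\ell(u)=j$; - the $(\mathbf 2+\mathbf 2)$-free poset $Q$ on the set of nodes of $T$, where $u<v$ if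 and only if $b(u)<\ell(v)$. **Proposition.** Let $T$ be a Fishburn tree with corresponding $x$, $A$ and $Q$. Then the following four conditions are equivalent: 1. $T$ is strictly decreasing: each node $r$ with left and right subtrees $L,R$ satisfies $\ell(r)>\max(L)$ and $\ell(r)>\max(R)$; 2. $x$ is primitive: there is no $i$ with $x_i=x_{i+1}$; 3. $A$ is binary: all its entries are $0$ or $1$; 4. $Q$ is primitive: no two distinct elements have the same strict down-set and the same strict up-set. Similarly, the following four conditions are equivalent: 1. $T$ is comb-shaped: only nodes on the diagonal have a left child; 2. $x$ is self-modified: $x$ is equal to the ascent sequence $y$ of which it is the modified version, $x=\hat y=y$; 3. the main diagonal of $A$ is strictly positive; 4. $Q$ contains a chain of maximum length: a chain whose number of elements is the number of levels of $Q$, that is, the number of distinct strict down-sets of elements of $Q$. Here an \emph{ascent sequence} is a map $y:\{1,\dots,n\}\to\{1,\dots,n\}$ with $y_1=1$ (if $n\ge1$) and $y_{i+1}\le 2+|\{j<i: y_j<y_{j+1}\}|$ for $1\le i<n$. Its modified version $\hat y$ is obtained by going through the indices $j$ with $y_j<y_{j+1}$ in increasing order and, for each of them, increasing by one all those current entries at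 positions $\le j$ that are at least the current entry at position $j+1$. -/

import Mathlib

namespace Fishburn

/-! ### Labeled binary trees and their nodes -/

/-- The two kinds of child. -/
inductive Dir where
  | left : Dir
  | right : Dir
  deriving DecidableEq

/-- The address of a node: the list of turns on the path between the node and the root, the
turn nearest to the node first. The root has address `[]`, and the left and right child of `v`
have addresses `Dir.left :: v` and `Dir.right :: v`; the parent of `d :: v` is `v`. -/
abbrev Address : Type := List Dir

/-- The label of the root (`0` for the empty tree). -/
def rootLabel : BinaryTree ℕ → ℕ
  | .nil => 0
  | .node a _ _ => a

/-- The subtree `T(v)` of `T` that consists of `v` and all its descendants (empty if there is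
no node with address `v`). -/
def subtreeAt (T : BinaryTree ℕ) : Address → BinaryTree ℕ
  | [] => T
  | .left :: v => (subtreeAt T v).left
  | .right :: v => (subtreeAt T v).right

/-- `V(T)`: the set of nodes of `T`. -/
def vertices (T : BinaryTree ℕ) : Set Address := {v | subtreeAt T v ≠ .nil}

/-- The label `ℓ(v)` of a node `v`. -/
def lbl (T : BinaryTree ℕ) (v : Address) : ℕ := rootLabel (subtreeAt T v)

/-- `max(T)`: the largest label, `0` for the empty tree. -/
def treeMax : BinaryTree ℕ → ℕ
  | .nil => 0
  | .node a l r => max a (max (treeMax l) (treeMax r))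

/-- Weakly decreasing trees: `ℓ(r) ≥ max {max L, max R}`, recursively. -/
def IsDecreasing : BinaryTree ℕ → Prop
  | .nil => True
  | .node a l r => max (treeMax l) (treeMax r) ≤ a ∧ IsDecreasing l ∧ IsDecreasing r

/-- Trees that are strictly decreasing to the left: `ℓ(r) > max L`, recursively. -/
def IsStrictlyDecreasingLeft : BinaryTree ℕ → Prop
  | .nil => True
  | .node a l r => treeMax l < a ∧ IsStrictlyDecreasingLeft l ∧ IsStrictlyDecreasingLeft r

/-- Strictly decreasing trees: `ℓ(r) > max {max L, max R}`, recursively. -/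
def IsStrictlyDecreasing : BinaryTree ℕ → Prop
  | .nil => True
  | .node a l r =>
      max (treeMax l) (treeMax r) < a ∧ IsStrictlyDecreasing l ∧ IsStrictlyDecreasing r

/-- The nodes `v₁, …, vₙ` of `T` in the order of the in-order traversal. -/
def inorder : BinaryTree ℕ → List Address
  | .nil => []
  | .node _ l r =>
      (inorder l).map (fun v => v ++ [Dir.left]) ++ [[]] ++
        (inorder r).map (fun v => v ++ [Dir.right])

/-- The in-order sequence `x = ℓ(v₁) … ℓ(vₙ)`. -/
def inorderSeq (T : BinaryTree ℕ) : List ℕ := (inorder T).map (lbl T)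

/-! ### Fishburn trees -/

/-- Endotrees: decreasing, strictly decreasing to the left, and with labels in `{1, …, n}`,
where `n` is the size. -/
def IsEndotree (T : BinaryTree ℕ) : Prop :=
  IsDecreasing T ∧ IsStrictlyDecreasingLeft T ∧ lbl T '' vertices T ⊆ Set.Icc 1 T.numNodes

/-- Regular endotrees: the labels form an interval `{1, …, k}`. -/
def IsRegularEndotree (T : BinaryTree ℕ) : Prop :=
  IsEndotree T ∧ ∃ k ≤ T.numNodes, lbl T '' vertices T = Set.Icc 1 k

/-- The set that consists of `v₁` and of the nodes that have a left child. -/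
def treetops (T : BinaryTree ℕ) : Set Address :=
  {v | (inorder T).head? = some v} ∪ {v ∈ vertices T | (subtreeAt T v).left ≠ .nil}

/-- The set of the nodes `vⱼ` such that `ℓ(vᵢ) ≠ ℓ(vⱼ)` for each `i < j`. -/
def unseen (T : BinaryTree ℕ) : Set Address :=
  {v | ∃ (j : ℕ) (hj : j < (inorder T).length), (inorder T)[j] = v ∧
    ∀ (i : ℕ) (hij : i < j), lbl T ((inorder T)[i]) ≠ lbl T v}

/-- Fishburn trees. -/
def IsFishburnTree (T : BinaryTree ℕ) : Prop :=
  IsRegularEndotree T ∧ unseen T = treetops T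

/-- The type of Fishburn trees. -/
structure FishburnTree where
  /-- the underlying labeled binary tree -/
  tree : BinaryTree ℕ
  isFishburn : IsFishburnTree tree

/-! ### Maximal right paths and the Fishburn cover -/

/-- The diagonal: the nodes of the maximal left path through the root. -/
def diag (T : BinaryTree ℕ) : Set Address := {v ∈ vertices T | ∀ d ∈ v, d = Dir.left}

/-- The first node of the maximal right path that contains `u`: climb from `u` as long as the
current node is a right child. -/
def pathTop (u : Address) : Address := u.dropWhile (fun d => d = Dir.right)

open Classical in
/-- The node associated with the maximal right path that contains `u`: the first node of the
path if that node is on the diagonal, and otherwise the parent of the first node. -/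
noncomputable def pathNode (T : BinaryTree ℕ) (u : Address) : Address :=
  if pathTop u ∈ diag T then pathTop u else (pathTop u).tail

/-- `b(u)`: the index of the maximal right path that contains `u`, which is the label of the
node associated with that path. -/
noncomputable def pathIndex (T : BinaryTree ℕ) (u : Address) : ℕ := lbl T (pathNode T u)

/-- The block `Bᵢ` of the Fishburn cover: the multiset of the labels of the nodes in the
maximal right path `Wᵢ` of index `i`. -/
noncomputable def cover (T : BinaryTree ℕ) (i : ℕ) : Multiset ℕ :=
  (((inorder T).filter (fun u => pathIndex T u = i)).map (lbl T) : List ℕ)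

/-- The Fishburn matrix of `T`: a `k × k` matrix, `k = max(T)`, whose `(i, j)` entry is the
multiplicity of `j` in `Bᵢ`. Rows and columns are numbered from `1` on paper and from `0` in
`Fin k`. -/
noncomputable def fishburnMatrix (T : BinaryTree ℕ) :
    Matrix (Fin (treeMax T)) (Fin (treeMax T)) ℕ :=
  Matrix.of fun i j => (cover T ((i : ℕ) + 1)).count ((j : ℕ) + 1)

/-! ### The poset of a Fishburn tree -/

theorem rootLabel_le_treeMax (T : BinaryTree ℕ) : rootLabel T ≤ treeMax T := by
  cases T <;> simp [rootLabel, treeMax]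

theorem IsDecreasing.subtreeAt {T : BinaryTree ℕ} (hT : IsDecreasing T) (v : Address) :
    IsDecreasing (subtreeAt T v) := by
  induction v with
  | nil => exact hT
  | cons d v ih =>
    cases d <;> simp only [Fishburn.subtreeAt] <;> cases h : Fishburn.subtreeAt T v <;>
      simp_all [IsDecreasing, BinaryTree.left, BinaryTree.right]

theorem lbl_cons_le {T : BinaryTree ℕ} (hT : IsDecreasing T) (d : Dir) (v : Address) :
    lbl T (d :: v) ≤ lbl T v := by
  have h1 := hT.subtreeAt v
  unfold lbl
  cases d <;> simp only [Fishburn.subtreeAt] <;> cases h : Fishburn.subtreeAt T v with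
  | nil => simp [rootLabel, BinaryTree.left, BinaryTree.right]
  | node a l r =>
    rw [h] at h1
    have hl := rootLabel_le_treeMax l
    have hr := rootLabel_le_treeMax r
    have := h1.1
    first
      | exact hl.trans ((le_max_left _ _).trans this)
      | exact hr.trans ((le_max_right _ _).trans this)

theorem lbl_le_pathIndex {T : BinaryTree ℕ} (hT : IsDecreasing T) (v : Address) :
    lbl T v ≤ pathIndex T v := by
  have h1 : ∀ u : Address, lbl T u ≤ lbl T (pathTop u) := by
    intro u
    induction u with
    | nil => simp [pathTop]
    | cons d u ih =>
      cases d with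
      | left => simp [pathTop]
      | right => exact (lbl_cons_le hT _ u).trans (by simpa [pathTop] using ih)
  have h2 : ∀ u : Address, lbl T u ≤ lbl T u.tail := by
    intro u
    cases u with
    | nil => simp
    | cons d u => exact lbl_cons_le hT d u
  unfold pathIndex pathNode
  split_ifs
  · exact h1 v
  · exact (h1 v).trans (h2 _)

/-- The underlying set of the poset `Q` of a Fishburn tree `T` is the set of nodes of `T`. -/
def FishburnTree.Poset (T : FishburnTree) : Type := {v : Address // v ∈ vertices T.tree}

/-- The order of the poset `Q` of a Fishburn tree: `u < v` if and only if `b(u) < ℓ(v)`. -/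
noncomputable instance (T : FishburnTree) : PartialOrder T.Poset where
  le u v := u = v ∨ pathIndex T.tree u.1 < lbl T.tree v.1
  lt u v := pathIndex T.tree u.1 < lbl T.tree v.1
  le_refl u := Or.inl rfl
  le_trans u v w huv hvw := by
    have hv := lbl_le_pathIndex T.isFishburn.1.1.1 v.1
    rcases huv with rfl | huv
    · exact hvw
    · rcases hvw with rfl | hvw
      · exact Or.inr huv
      · exact Or.inr (by omega)
  le_antisymm u v huv hvu := by
    have hu := lbl_le_pathIndex T.isFishburn.1.1.1 u.1
    have hv := lbl_le_pathIndex T.isFishburn.1.1.1 v.1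
    rcases huv with h | huv
    · exact h
    · rcases hvu with h | hvu
      · exact h.symm
      · omega
  lt_iff_le_not_ge u v := by
    have hu := lbl_le_pathIndex T.isFishburn.1.1.1 u.1
    have hv := lbl_le_pathIndex T.isFishburn.1.1.1 v.1
    constructor
    · intro h
      refine ⟨Or.inr h, ?_⟩
      rintro (rfl | h') <;> omega
    · rintro ⟨rfl | h, h'⟩
      · exact absurd (Or.inl rfl) h'
      · exact h

/-! ### Ascent sequences and their modification -/

/-- The (zero-based) positions of the ascent tops of `x`; the first position counts as one. -/
def ascentTops (x : List ℕ) : Finset ℕ :=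
  (Finset.range x.length).filter (fun i => i = 0 ∨ x.getD (i - 1) 0 < x.getD i 0)

/-- Ascent sequences: endofunctions `x` of `{1, …, n}` with `x₁ = 1` and
`xᵢ₊₁ ≤ |asctops(x₁ ⋯ xᵢ)| + 1`. -/
def IsAscentSequence (x : List ℕ) : Prop :=
  (∀ a ∈ x, a ∈ Set.Icc 1 x.length) ∧ (∀ h : 0 < x.length, x[0] = 1) ∧
    ∀ (i : ℕ) (h : i + 1 < x.length), x[i + 1] ≤ (ascentTops (x.take (i + 1))).card + 1

/-- The (zero-based) positions `j` with `xⱼ < xⱼ₊₁`, in increasing order. -/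
def ascents (x : List ℕ) : List ℕ :=
  (List.range (x.length - 1)).filter (fun j => x.getD j 0 < x.getD (j + 1) 0)

/-- One step of the modification: increase by one all entries `xᵢ` with `i ≤ j` and
`xᵢ ≥ xⱼ₊₁`. -/
def bump (x : List ℕ) (j : ℕ) : List ℕ :=
  x.mapIdx (fun i a => if i ≤ j ∧ x.getD (j + 1) 0 ≤ a then a + 1 else a)

/-- The modified version of an ascent sequence `x`: perform the steps for the ascents of `x`,
from left to right. -/
def modify (x : List ℕ) : List ℕ := (ascents x).foldl bump x

/-! ### The conditions of the theorem -/

/-- `x` has no flat step `xᵢ = xᵢ₊₁`. -/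
def IsPrimitiveSeq (x : List ℕ) : Prop :=
  ∀ (i : ℕ) (h : i + 1 < x.length), x[i] ≠ x[i + 1]

/-- `x` is equal to the ascent sequence `y` of which it is the modified version. -/
def IsSelfModified (x : List ℕ) : Prop :=
  ∃ y : List ℕ, IsAscentSequence y ∧ modify y = x ∧ x = y

/-- Comb-shaped trees: right paths attached to the diagonal; that is, only nodes on the
diagonal have a left child. -/
def IsCombShaped (T : BinaryTree ℕ) : Prop :=
  ∀ v ∈ vertices T, (subtreeAt T v).left ≠ .nil → v ∈ diag T

/-- Two elements are indistinguishable if they have the same strict down-set and the same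
strict up-set. -/
def Indistinguishable {α : Type*} [PartialOrder α] (u v : α) : Prop :=
  Set.Iio u = Set.Iio v ∧ Set.Ioi u = Set.Ioi v

/-- A poset is primitive if no two distinct elements are indistinguishable. -/
def IsPrimitivePoset (α : Type*) [PartialOrder α] : Prop :=
  ∀ u v : α, u ≠ v → ¬ Indistinguishable u v

/-- The number of levels of a poset: the number of its distinct strict down-sets. -/
noncomputable def numLevels (α : Type*) [PartialOrder α] : ℕ :=
  (Set.range (fun u : α => Set.Iio u)).ncard

/-- The poset contains a chain of maximum length, that is, a chain with as many elements as the
poset has levels. (Comparable elements lie on different levels, so no chain is longer.) -/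
def HasChainOfMaximumLength (α : Type*) [PartialOrder α] : Prop :=
  ∃ c : Finset α, IsChain (· ≤ ·) (c : Set α) ∧ c.card = numLevels α

end Fishburn

namespace Fishburn

/-! ### Addresses and subtrees -/

/-! Everything is read off the pairs `(b(u), ℓ(u))`, with `ℓ(u) ≤ b(u)`. In a Fishburn tree the
treetops (the first node in in-order and the nodes with a left child) are the first occurrences of
the labels, so each label `1, …, k` belongs to exactly one treetop. The map `pathNode` sends the
nodes onto the treetops, and its fibres are the maximal right paths; hence `b` takes all values `1,
…, k`, and `b(u)` determines the path of `u` (`pathTop_eq_of_pathIndex_eq`). It follows that in `Q`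
strict down-sets correspond to labels and strict up-sets to values of `b`.

For the first equivalence, a binary matrix and a primitive poset both say that `u ↦ (b(u), ℓ(u))` is
injective, that is, that labels are distinct along each right path. Since left steps are strict
anyway, this is strict decrease. A flat right step ends at a node that is not a treetop, hence has
no left child and immediately follows its parent in in-order: it is a flat step of `x`.

For the second, comb shape means that all treetops lie on the diagonal. Apart from the first node,
treetops are the ascent tops of `x` (`lbl_lt_succ_iff`); one on the diagonal exceeds everything
before it, one off the diagonal does not, and `modify` fixes `x` exactly when every ascent top
exceeds all earlier entries. A diagonal treetop labeled `i` has `b = i`, whereas an off-diagonal one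
indexes a path whose labels are all smaller than `i`; this governs the diagonal of the matrix.
Finally `Q` has `k` levels, and a chain of `k` elements uses each label once, which forces `b = ℓ`
on it (`hasChainOfMaximumLength_iff`). -/

theorem subtreeAt_nil (v : Address) : subtreeAt .nil v = .nil := by
  induction v with
  | nil => rfl
  | cons d v ih => cases d <;> simp [subtreeAt, ih, BinaryTree.left, BinaryTree.right]

/-- Addresses list the deepest turn first, so `s ++ v` is a descendant of `v`. -/
theorem subtreeAt_append (T : BinaryTree ℕ) (s v : Address) :
    subtreeAt T (s ++ v) = subtreeAt (subtreeAt T v) s := by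
  induction s with
  | nil => rfl
  | cons d s ih => cases d <;> simp [subtreeAt, ih]

theorem mem_vertices_of_append {T : BinaryTree ℕ} {s v : Address} (h : s ++ v ∈ vertices T) :
    v ∈ vertices T := by
  intro hv
  exact h (by rw [subtreeAt_append, hv, subtreeAt_nil])

theorem mem_vertices_of_cons {T : BinaryTree ℕ} {d : Dir} {v : Address}
    (h : d :: v ∈ vertices T) : v ∈ vertices T :=
  mem_vertices_of_append (s := [d]) h

theorem mem_vertices_append_left {a : ℕ} {l r : BinaryTree ℕ} {v : Address} :
    v ++ [Dir.left] ∈ vertices (.node a l r) ↔ v ∈ vertices l := by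
  simp [vertices, subtreeAt_append, subtreeAt, BinaryTree.left]

theorem mem_vertices_append_right {a : ℕ} {l r : BinaryTree ℕ} {v : Address} :
    v ++ [Dir.right] ∈ vertices (.node a l r) ↔ v ∈ vertices r := by
  simp [vertices, subtreeAt_append, subtreeAt, BinaryTree.right]

/-! ### In-order traversal -/

theorem mem_inorder {T : BinaryTree ℕ} {v : Address} : v ∈ inorder T ↔ v ∈ vertices T := by
  induction T generalizing v with
  | nil => simp [inorder, vertices, subtreeAt_nil]
  | node a l r ihl ihr =>
    rcases List.eq_nil_or_concat' v with rfl | ⟨w, d, rfl⟩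
    · simp [inorder, vertices, subtreeAt]
    · cases d
      · rw [mem_vertices_append_left, ← ihl]
        simp [inorder]
      · rw [mem_vertices_append_right, ← ihr]
        simp [inorder]

theorem nodup_inorder (T : BinaryTree ℕ) : (inorder T).Nodup := by
  induction T with
  | nil => simp [inorder]
  | node a l r ihl ihr =>
    have h : ∀ d : Dir, Function.Injective (fun v : Address => v ++ [d]) :=
      fun d _ _ h => List.append_cancel_right h
    simp only [inorder, List.append_assoc, List.nodup_append, ihl.map (h _), ihr.map (h _)]
    simp

theorem head?_inorder {T : BinaryTree ℕ} (hT : T ≠ .nil) :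
    ∃ n, (inorder T).head? = some (List.replicate n Dir.left) ∧
      (subtreeAt T (List.replicate n Dir.left)).left = .nil := by
  induction T with
  | nil => exact absurd rfl hT
  | node a l r ihl _ =>
    by_cases hl : l = .nil
    · subst hl
      exact ⟨0, by simp [inorder], by simp [subtreeAt, BinaryTree.left]⟩
    · obtain ⟨n, h1, h2⟩ := ihl hl
      refine ⟨n + 1, ?_, ?_⟩
      · simp [inorder, h1, List.replicate_succ']
      · rw [List.replicate_succ', subtreeAt_append]
        exact h2

theorem getLast?_inorder {T : BinaryTree ℕ} (hT : T ≠ .nil) :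
    ∃ n, (inorder T).getLast? = some (List.replicate n Dir.right) := by
  induction T with
  | nil => exact absurd rfl hT
  | node a l r _ ihr =>
    by_cases hr : r = .nil
    · subst hr
      exact ⟨0, by simp [inorder]⟩
    · obtain ⟨n, h1⟩ := ihr hr
      refine ⟨n + 1, ?_⟩
      rw [inorder, List.append_assoc, List.singleton_append, List.getLast?_append_cons, ← List.singleton_append,
        List.getLast?_append, List.getLast?_map, h1]
      simp [List.replicate_succ']

/-- `v` is the in-order successor of `u`: either `u` is the last node of the left subtree of `v`,
or `v` is the first node of the right subtree of `u`. -/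
def InorderSucc (T : BinaryTree ℕ) (u v : Address) : Prop :=
  (∃ n, u = List.replicate n Dir.right ++ Dir.left :: v) ∨
    (subtreeAt T v).left = .nil ∧ ∃ n, v = List.replicate n Dir.left ++ Dir.right :: u

/-- The two junctions at the root give the two cases of `InorderSucc`; steps inside a subtree are
inherited, since lifting appends the same final turn to both addresses. -/
theorem isChain_inorder (T : BinaryTree ℕ) : (inorder T).IsChain (InorderSucc T) := by
  induction T with
  | nil => simp [inorder]
  | node a l r ihl ihr =>
    have hsucc : ∀ d u v, InorderSucc (subtreeAt (.node a l r) [d]) u v →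
        InorderSucc (.node a l r) (u ++ [d]) (v ++ [d]) := by
      rintro d u v (⟨n, rfl⟩ | ⟨h, n, rfl⟩)
      · exact Or.inl ⟨n, by simp⟩
      · exact Or.inr ⟨by rw [subtreeAt_append, h], n, by simp⟩
    simp only [inorder, List.append_assoc]
    refine List.isChain_append.2 ⟨List.isChain_map_of_isChain _ (hsucc .left) ihl,
      List.isChain_append.2 ⟨by simp, List.isChain_map_of_isChain _ (hsucc .right) ihr, ?_⟩, ?_⟩
    · intro u hu v hv
      by_cases hr : r = .nil
      · simp [hr, inorder] at hv
      · obtain ⟨n, h1, h2⟩ := head?_inorder hr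
        simp only [List.head?_map, h1, Option.map_some, Option.mem_def, Option.some.injEq] at hv
        have hu' : u = [] := by simpa using hu.symm
        subst hu' hv
        exact Or.inr ⟨by rw [subtreeAt_append]; exact h2, n, rfl⟩
    · intro u hu v hv
      by_cases hl : l = .nil
      · simp [hl, inorder] at hu
      · obtain ⟨n, h1⟩ := getLast?_inorder hl
        simp only [List.getLast?_map, h1, Option.map_some, Option.mem_def,
          Option.some.injEq] at hu
        have hv' : v = [] := by simpa using hv.symm
        subst hu hv'
        exact Or.inl ⟨n, rfl⟩

theorem inorderSucc_getElem (T : BinaryTree ℕ) {i : ℕ} (h : i + 1 < (inorder T).length) :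
    InorderSucc T (inorder T)[i] (inorder T)[i + 1] :=
  List.isChain_iff_getElem.1 (isChain_inorder T) i h

theorem pairwise_inorder (T : BinaryTree ℕ) :
    (inorder T).Pairwise fun u v => (∀ s, u ≠ s ++ Dir.right :: v) ∧
      ((∀ d ∈ v, d = Dir.left) → ∃ s, u = s ++ Dir.left :: v) := by
  induction T with
  | nil => simp [inorder]
  | node a l r ihl ihr =>
    have key : ∀ (d : Dir) (u v s : Address),
        u ++ [d] = s ++ Dir.right :: (v ++ [d]) → u = s ++ Dir.right :: v := by
      intro d u v s h
      exact List.append_cancel_right (by simpa using h : u ++ [d] = (s ++ Dir.right :: v) ++ [d])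
    -- Nodes of the right subtree are never on the diagonal, so the second claim is vacuous for
    -- them.
    have hr : ∀ v : Address, ¬ ∀ d ∈ v ++ [Dir.right], d = Dir.left := fun v h =>
      Dir.noConfusion (h Dir.right (by simp))
    simp only [inorder, List.append_assoc, List.pairwise_append, List.pairwise_map]
    refine ⟨ihl.imp ?_, ⟨by simp, ihr.imp ?_, ?_⟩, ?_⟩
    · rintro u v ⟨h1, h2⟩
      refine ⟨fun s h => h1 s (key _ _ _ _ h), fun h => ?_⟩
      obtain ⟨s, rfl⟩ := h2 fun d hd => h d (by simp [hd])
      exact ⟨s, by simp⟩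
    · rintro u v ⟨h1, h2⟩
      exact ⟨fun s h => h1 s (key _ _ _ _ h), fun h => absurd h (hr v)⟩
    · intro u hu v hv
      obtain rfl : u = [] := by simpa using hu
      obtain ⟨w, -, rfl⟩ := List.mem_map.1 hv
      exact ⟨by simp, fun h => absurd h (hr w)⟩
    · intro u hu v hv
      obtain ⟨w, -, rfl⟩ := List.mem_map.1 hu
      rcases List.mem_append.1 hv with hv | hv
      · obtain rfl : v = [] := by simpa using hv
        refine ⟨fun s h => ?_, fun _ => ⟨w, rfl⟩⟩
        simpa using (List.append_inj' h rfl).2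
      · obtain ⟨z, -, rfl⟩ := List.mem_map.1 hv
        refine ⟨fun s h => ?_, fun h => absurd h (hr z)⟩
        have : w ++ [Dir.left] = (s ++ Dir.right :: z) ++ [Dir.right] := by simpa using h
        simpa using (List.append_inj' this rfl).2

/-- A node precedes the nodes of its right subtree. -/
theorem index_lt_of_right {T : BinaryTree ℕ} {i j : ℕ} (hi : i < (inorder T).length)
    (hj : j < (inorder T).length) {s : Address}
    (h : (inorder T)[j] = s ++ Dir.right :: (inorder T)[i]) : i < j := by
  rcases lt_trichotomy i j with hij | rfl | hij
  · exact hij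
  · have := congrArg List.length h
    simp at this
    omega
  · exact absurd h ((List.pairwise_iff_getElem.1 (pairwise_inorder T) j i hj hi hij).1 s)

/-- The nodes that precede a node on the diagonal belong to its left subtree. -/
theorem exists_append_of_index_lt {T : BinaryTree ℕ} {i j : ℕ} (hi : i < (inorder T).length)
    (hj : j < (inorder T).length) (hij : i < j) (hd : (inorder T)[j] ∈ diag T) :
    ∃ s, (inorder T)[i] = s ++ Dir.left :: (inorder T)[j] :=
  (List.pairwise_iff_getElem.1 (pairwise_inorder T) i j hi hj hij).2 hd.2

theorem length_inorder (T : BinaryTree ℕ) : (inorder T).length = T.numNodes := by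
  induction T with
  | nil => rfl
  | node a l r ihl ihr => simp [inorder, ihl, ihr]; omega

/-! ### Labels -/

theorem lbl_append_le {T : BinaryTree ℕ} (hT : IsDecreasing T) (s v : Address) :
    lbl T (s ++ v) ≤ lbl T v := by
  induction s with
  | nil => simp
  | cons d s ih => exact (lbl_cons_le hT d _).trans ih

theorem IsStrictlyDecreasingLeft.subtreeAt {T : BinaryTree ℕ} (hT : IsStrictlyDecreasingLeft T)
    (v : Address) : IsStrictlyDecreasingLeft (subtreeAt T v) := by
  induction v with
  | nil => exact hT
  | cons d v ih =>
    cases d <;> simp only [Fishburn.subtreeAt] <;> cases h : Fishburn.subtreeAt T v <;>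
      simp_all [IsStrictlyDecreasingLeft, BinaryTree.left, BinaryTree.right]

theorem IsStrictlyDecreasing.subtreeAt {T : BinaryTree ℕ} (hT : IsStrictlyDecreasing T)
    (v : Address) : IsStrictlyDecreasing (subtreeAt T v) := by
  induction v with
  | nil => exact hT
  | cons d v ih =>
    cases d <;> simp only [Fishburn.subtreeAt] <;> cases h : Fishburn.subtreeAt T v <;>
      simp_all [IsStrictlyDecreasing, BinaryTree.left, BinaryTree.right]

theorem lbl_left_lt {T : BinaryTree ℕ} (hT : IsStrictlyDecreasingLeft T) {v : Address}
    (hv : v ∈ vertices T) : lbl T (Dir.left :: v) < lbl T v := by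
  have h1 := hT.subtreeAt v
  unfold lbl
  simp only [subtreeAt]
  cases h : subtreeAt T v with
  | nil => exact absurd h hv
  | node a l r =>
    rw [h] at h1
    exact (rootLabel_le_treeMax l).trans_lt h1.1

theorem lbl_right_lt {T : BinaryTree ℕ} (hT : IsStrictlyDecreasing T) {v : Address}
    (hv : v ∈ vertices T) : lbl T (Dir.right :: v) < lbl T v := by
  have h1 := hT.subtreeAt v
  unfold lbl
  simp only [subtreeAt]
  cases h : subtreeAt T v with
  | nil => exact absurd h hv
  | node a l r =>
    rw [h] at h1
    exact ((rootLabel_le_treeMax r).trans (le_max_right _ _)).trans_lt h1.1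

theorem IsDecreasing.treeMax_eq {T : BinaryTree ℕ} (hT : IsDecreasing T) :
    treeMax T = lbl T [] := by
  cases T with
  | nil => rfl
  | node a l r => exact max_eq_left hT.1

theorem IsDecreasing.lbl_le_treeMax {T : BinaryTree ℕ} (hT : IsDecreasing T) (v : Address) :
    lbl T v ≤ treeMax T := by
  rw [hT.treeMax_eq]
  simpa using lbl_append_le hT v []

/-- The hypotheses are those that pass to subtrees, unlike being a Fishburn tree. Positivity handles
an empty right subtree, whose maximum is `0`. -/
theorem isStrictlyDecreasing_of_lbl_right_lt {T : BinaryTree ℕ} (hT : IsDecreasing T)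
    (hl : IsStrictlyDecreasingLeft T) (hpos : ∀ v ∈ vertices T, 0 < lbl T v)
    (h : ∀ v, Dir.right :: v ∈ vertices T → lbl T (Dir.right :: v) < lbl T v) :
    IsStrictlyDecreasing T := by
  induction T with
  | nil => trivial
  | node a l r ihl ihr =>
    have hleft : ∀ v, lbl (.node a l r) (v ++ [Dir.left]) = lbl l v := fun v => by
      simp [lbl, subtreeAt_append, subtreeAt, BinaryTree.left]
    have hright : ∀ v, lbl (.node a l r) (v ++ [Dir.right]) = lbl r v := fun v => by
      simp [lbl, subtreeAt_append, subtreeAt, BinaryTree.right]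
    refine ⟨max_lt hl.1 ?_, ihl hT.2.1 hl.2.1 ?_ ?_, ihr hT.2.2 hl.2.2 ?_ ?_⟩
    · by_cases hr : r = .nil
      · subst hr
        exact hpos [] (by simp [vertices, subtreeAt])
      · rw [hT.2.2.treeMax_eq]
        exact h [] (by simpa [vertices, subtreeAt, BinaryTree.right] using hr)
    · intro v hv
      rw [← hleft]
      exact hpos _ (mem_vertices_append_left.2 hv)
    · intro v hv
      have := h (v ++ [Dir.left]) (mem_vertices_append_left.2 hv)
      rwa [← List.cons_append, hleft, hleft] at this
    · intro v hv
      rw [← hright]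
      exact hpos _ (mem_vertices_append_right.2 hv)
    · intro v hv
      have := h (v ++ [Dir.right]) (mem_vertices_append_right.2 hv)
      rwa [← List.cons_append, hright, hright] at this

namespace IsFishburnTree

variable {T : BinaryTree ℕ}

theorem isDecreasing (hT : IsFishburnTree T) : IsDecreasing T := hT.1.1.1

theorem isStrictlyDecreasingLeft (hT : IsFishburnTree T) : IsStrictlyDecreasingLeft T :=
  hT.1.1.2.1

/-- The root carries the largest label, which identifies `k`; for the empty tree both are `0`. -/
theorem lbl_image (hT : IsFishburnTree T) : lbl T '' vertices T = Set.Icc 1 (treeMax T) := by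
  obtain ⟨k, -, hk⟩ := hT.1.2
  rw [hk]
  congr 1
  rw [hT.isDecreasing.treeMax_eq]
  by_cases h : T = .nil
  · subst h
    have h1 : Set.Icc 1 k = (∅ : Set ℕ) := by
      rw [← hk]
      simp [vertices, subtreeAt_nil]
    rw [Set.Icc_eq_empty_iff] at h1
    simp only [lbl, rootLabel, subtreeAt]
    omega
  · have h0 : lbl T [] ∈ Set.Icc 1 k := hk ▸ ⟨[], h, rfl⟩
    refine le_antisymm ?_ h0.2
    obtain ⟨v, -, hv⟩ : k ∈ lbl T '' vertices T := hk ▸ ⟨h0.1.trans h0.2, le_rfl⟩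
    rw [← hv]
    simpa using lbl_append_le hT.isDecreasing v []

theorem lbl_mem (hT : IsFishburnTree T) {v : Address} (hv : v ∈ vertices T) :
    1 ≤ lbl T v ∧ lbl T v ≤ treeMax T :=
  hT.lbl_image.subset ⟨v, hv, rfl⟩

theorem exists_lbl_eq (hT : IsFishburnTree T) {i : ℕ} (h1 : 1 ≤ i) (h2 : i ≤ treeMax T) :
    ∃ v ∈ vertices T, lbl T v = i := by
  have : i ∈ lbl T '' vertices T := hT.lbl_image ▸ ⟨h1, h2⟩
  exact this

/-! ### Treetops and maximal right paths -/

theorem mem_vertices_of_mem_treetops {v : Address} (hv : v ∈ treetops T) : v ∈ vertices T := by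
  rcases hv with hv | hv
  · exact mem_inorder.1 (List.mem_of_mem_head? hv)
  · exact hv.1

theorem treetop_eq_of_lbl_eq (hT : IsFishburnTree T) {u v : Address} (hu : u ∈ treetops T)
    (hv : v ∈ treetops T) (h : lbl T u = lbl T v) : u = v := by
  rw [← hT.2] at hu hv
  obtain ⟨i, hi, rfl, hi'⟩ := hu
  obtain ⟨j, hj, rfl, hj'⟩ := hv
  rcases lt_trichotomy i j with hij | rfl | hij
  · exact absurd h (hj' i hij)
  · rfl
  · exact absurd h.symm (hi' j hij)

/-- The first node with a given label is a treetop. -/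
theorem exists_treetop_index_le (hT : IsFishburnTree T) {j : ℕ} (hj : j < (inorder T).length) :
    ∃ i, ∃ hi : i ≤ j, (inorder T)[i] ∈ treetops T ∧
      lbl T (inorder T)[i] = lbl T (inorder T)[j] := by
  classical
  have hex : ∃ i, ∃ hi : i ≤ j, lbl T (inorder T)[i] = lbl T (inorder T)[j] := ⟨j, le_rfl, rfl⟩
  obtain ⟨hi, h⟩ := Nat.find_spec hex
  refine ⟨Nat.find hex, hi, ?_, h⟩
  rw [← hT.2]
  refine ⟨Nat.find hex, hi.trans_lt hj, rfl, fun i hi' h' => ?_⟩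
  exact Nat.find_min hex hi' ⟨hi'.le.trans hi, h'.trans h⟩

theorem exists_treetop_lbl_eq (hT : IsFishburnTree T) {i : ℕ} (h1 : 1 ≤ i)
    (h2 : i ≤ treeMax T) : ∃ v ∈ treetops T, lbl T v = i := by
  obtain ⟨v, hv, rfl⟩ := hT.exists_lbl_eq h1 h2
  obtain ⟨j, hj, rfl⟩ := List.getElem_of_mem (mem_inorder.2 hv)
  obtain ⟨i, hi, h, h'⟩ := hT.exists_treetop_index_le hj
  exact ⟨_, h, h'⟩

end IsFishburnTree

theorem mem_diag_of_head? {T : BinaryTree ℕ} {v : Address} (h : (inorder T).head? = some v) :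
    v ∈ diag T := by
  have hv : v ∈ vertices T := mem_inorder.1 (List.mem_of_mem_head? h)
  have hT : T ≠ .nil := by
    rintro rfl
    simp [inorder] at h
  obtain ⟨n, h1, -⟩ := head?_inorder hT
  obtain rfl : List.replicate n Dir.left = v := by simpa [h1] using h
  exact ⟨hv, fun d hd => List.eq_of_mem_replicate hd⟩

theorem left_ne_nil_of_mem_treetops {T : BinaryTree ℕ} {v : Address} (hv : v ∈ treetops T)
    (hd : v ∉ diag T) : (subtreeAt T v).left ≠ .nil := by
  rcases hv with hv | hv
  · exact absurd (mem_diag_of_head? hv) hd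
  · exact hv.2

/-- A diagonal node without left child is first in in-order: a predecessor would lie in its left
subtree or force a right turn in its address. -/
theorem diag_subset_treetops (T : BinaryTree ℕ) : diag T ⊆ treetops T := by
  intro v hv
  by_cases hl : (subtreeAt T v).left = .nil
  · left
    obtain ⟨j, hj, rfl⟩ := List.getElem_of_mem (mem_inorder.2 hv.1)
    cases j with
    | zero => simp [List.head?_eq_getElem?, hj]
    | succ j =>
      exfalso
      rcases inorderSucc_getElem T hj with ⟨n, h⟩ | ⟨-, n, h⟩
      · have hu := mem_inorder.1 (List.getElem_mem (l := inorder T) (n := j) (by omega))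
        rw [h] at hu
        exact mem_vertices_of_append hu hl
      · exact Dir.noConfusion (hv.2 Dir.right (by rw [h]; simp))
  · exact Or.inr ⟨hv.1, hl⟩

theorem mem_diag_cons_left {T : BinaryTree ℕ} {v : Address} (h : Dir.left :: v ∈ vertices T) :
    Dir.left :: v ∈ diag T ↔ v ∈ diag T := by
  simp [diag, h, mem_vertices_of_cons h]

theorem exists_eq_append_pathTop (u : Address) :
    ∃ n, u = List.replicate n Dir.right ++ pathTop u := by
  induction u with
  | nil => exact ⟨0, rfl⟩
  | cons d u ih =>
    cases d with
    | left => exact ⟨0, by simp [pathTop]⟩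
    | right =>
      obtain ⟨n, hn⟩ := ih
      refine ⟨n + 1, ?_⟩
      have : pathTop (Dir.right :: u) = pathTop u := by simp [pathTop]
      rw [this, List.replicate_succ, List.cons_append, ← hn]

theorem pathTop_eq (u : Address) : pathTop u = [] ∨ ∃ p, pathTop u = Dir.left :: p := by
  induction u with
  | nil => exact Or.inl rfl
  | cons d u ih =>
    cases d with
    | left => exact Or.inr ⟨u, by simp [pathTop]⟩
    | right => simpa [pathTop] using ih

theorem pathTop_mem_vertices {T : BinaryTree ℕ} {u : Address} (hu : u ∈ vertices T) :
    pathTop u ∈ vertices T := by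
  obtain ⟨n, hn⟩ := exists_eq_append_pathTop u
  rw [hn] at hu
  exact mem_vertices_of_append hu

theorem pathTop_of_mem_diag {T : BinaryTree ℕ} {u : Address} (hu : u ∈ diag T) :
    pathTop u = u := by
  cases u with
  | nil => rfl
  | cons d u =>
    obtain rfl : d = Dir.left := hu.2 d (by simp)
    simp [pathTop]

theorem exists_pathTop_eq_left_of_notMem_diag {T : BinaryTree ℕ} {u : Address}
    (hu : u ∈ vertices T) (hd : pathTop u ∉ diag T) :
    ∃ p, pathTop u = Dir.left :: p ∧ p ∉ diag T := by
  have hu' := pathTop_mem_vertices hu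
  rcases pathTop_eq u with h | ⟨p, h⟩
  · rw [h] at hu' hd
    exact absurd ⟨hu', by simp⟩ hd
  · rw [h] at hu' hd
    exact ⟨p, h, fun hp => hd ((mem_diag_cons_left hu').2 hp)⟩

theorem pathNode_mem_treetops {T : BinaryTree ℕ} {u : Address} (hu : u ∈ vertices T) :
    pathNode T u ∈ treetops T := by
  unfold pathNode
  split_ifs with hd
  · exact diag_subset_treetops T hd
  · obtain ⟨p, h, -⟩ := exists_pathTop_eq_left_of_notMem_diag hu hd
    have hu' := pathTop_mem_vertices hu
    rw [h] at hu' ⊢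
    exact Or.inr ⟨mem_vertices_of_cons hu', hu'⟩

/-- The two cases of `pathNode` cannot collide: one yields a node on the diagonal, the other a node
off it. -/
theorem pathTop_eq_of_pathNode_eq {T : BinaryTree ℕ} {u v : Address} (hu : u ∈ vertices T)
    (hv : v ∈ vertices T) (h : pathNode T u = pathNode T v) : pathTop u = pathTop v := by
  unfold pathNode at h
  split_ifs at h with h1 h2 h2
  · exact h
  · obtain ⟨p, hp, hpd⟩ := exists_pathTop_eq_left_of_notMem_diag hv h2
    rw [hp, List.tail_cons] at h
    exact absurd (h ▸ h1) hpd
  · obtain ⟨p, hp, hpd⟩ := exists_pathTop_eq_left_of_notMem_diag hu h1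
    rw [hp, List.tail_cons] at h
    exact absurd (h ▸ h2) hpd
  · obtain ⟨p, hp, -⟩ := exists_pathTop_eq_left_of_notMem_diag hu h1
    obtain ⟨q, hq, -⟩ := exists_pathTop_eq_left_of_notMem_diag hv h2
    rw [hp, hq, List.tail_cons, List.tail_cons] at h
    rw [hp, hq, h]

theorem pathNode_of_mem_diag {T : BinaryTree ℕ} {v : Address} (hv : v ∈ diag T) :
    pathNode T v = v := by
  rw [pathNode, pathTop_of_mem_diag hv, if_pos hv]

theorem pathNode_left {T : BinaryTree ℕ} {v : Address} (hl : Dir.left :: v ∈ vertices T)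
    (hv : v ∉ diag T) : pathNode T (Dir.left :: v) = v := by
  have h : pathTop (Dir.left :: v) = Dir.left :: v := by simp [pathTop]
  rw [pathNode, h, if_neg (fun h' => hv ((mem_diag_cons_left hl).1 h')), List.tail_cons]

/-- A diagonal treetop is its own path node; any other treetop has a left child, whose path it
indexes. -/
theorem exists_pathNode_eq {T : BinaryTree ℕ} {v : Address} (hv : v ∈ treetops T) :
    ∃ u ∈ vertices T, pathNode T u = v := by
  by_cases hd : v ∈ diag T
  · exact ⟨v, hd.1, pathNode_of_mem_diag hd⟩
  · have hl : Dir.left :: v ∈ vertices T := left_ne_nil_of_mem_treetops hv hd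
    exact ⟨Dir.left :: v, hl, pathNode_left hl hd⟩

namespace IsFishburnTree

variable {T : BinaryTree ℕ}

theorem pathIndex_mem (hT : IsFishburnTree T) {v : Address} (hv : v ∈ vertices T) :
    1 ≤ pathIndex T v ∧ pathIndex T v ≤ treeMax T :=
  hT.lbl_mem (mem_vertices_of_mem_treetops (pathNode_mem_treetops hv))

theorem exists_pathIndex_eq (hT : IsFishburnTree T) {i : ℕ} (h1 : 1 ≤ i)
    (h2 : i ≤ treeMax T) : ∃ u ∈ vertices T, pathIndex T u = i := by
  obtain ⟨v, hv, rfl⟩ := hT.exists_treetop_lbl_eq h1 h2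
  obtain ⟨u, hu, rfl⟩ := exists_pathNode_eq hv
  exact ⟨u, hu, rfl⟩

theorem pathTop_eq_of_pathIndex_eq (hT : IsFishburnTree T) {u v : Address}
    (hu : u ∈ vertices T) (hv : v ∈ vertices T) (h : pathIndex T u = pathIndex T v) :
    pathTop u = pathTop v :=
  pathTop_eq_of_pathNode_eq hu hv
    (hT.treetop_eq_of_lbl_eq (pathNode_mem_treetops hu) (pathNode_mem_treetops hv) h)

end IsFishburnTree

/-! ### Entries of the Fishburn matrix -/

theorem fishburnMatrix_eq_length (T : BinaryTree ℕ) (i j : Fin (treeMax T)) :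
    fishburnMatrix T i j = ((inorder T).filter fun u =>
      decide (lbl T u = j + 1) && decide (pathIndex T u = i + 1)).length := by
  simp only [fishburnMatrix, Matrix.of_apply, cover, Multiset.coe_count, List.count,
    List.countP_eq_length_filter]
  rw [List.filter_map, List.length_map, List.filter_filter]
  rfl

theorem fishburnMatrix_pos {T : BinaryTree ℕ} {i j : Fin (treeMax T)} :
    0 < fishburnMatrix T i j ↔
      ∃ u ∈ vertices T, pathIndex T u = i + 1 ∧ lbl T u = j + 1 := by
  rw [fishburnMatrix_eq_length, List.length_pos_iff_exists_mem]
  simp [mem_inorder, and_comm]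

theorem fishburnMatrix_le_one {T : BinaryTree ℕ} {i j : Fin (treeMax T)} :
    fishburnMatrix T i j ≤ 1 ↔ ∀ u ∈ vertices T, ∀ v ∈ vertices T,
      pathIndex T u = i + 1 → lbl T u = j + 1 → pathIndex T v = i + 1 → lbl T v = j + 1 →
        u = v := by
  rw [fishburnMatrix_eq_length, ← List.toFinset_card_of_nodup ((nodup_inorder T).filter _),
    Finset.card_le_one]
  simp only [List.mem_toFinset, List.mem_filter, mem_inorder, Bool.and_eq_true, decide_eq_true_eq]
  constructor
  · intro h u hu v hv h1 h2 h3 h4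
    exact h u ⟨hu, h2, h1⟩ v ⟨hv, h4, h3⟩
  · rintro h u ⟨hu, h2, h1⟩ v ⟨hv, h4, h3⟩
    exact h u hu v hv h1 h2 h3 h4

/-! ### Fixed points of the modification -/

theorem length_bump (x : List ℕ) (j : ℕ) : (bump x j).length = x.length := by
  simp [bump]

theorem forall₂_le_bump (x : List ℕ) (j : ℕ) : List.Forall₂ (· ≤ ·) x (bump x j) := by
  refine List.forall₂_iff_get.2 ⟨(length_bump x j).symm, fun i h1 h2 => ?_⟩
  simp only [List.get_eq_getElem, bump, List.getElem_mapIdx]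
  split_ifs <;> omega

theorem forall₂_le_trans {x y z : List ℕ} (h1 : List.Forall₂ (· ≤ ·) x y)
    (h2 : List.Forall₂ (· ≤ ·) y z) : List.Forall₂ (· ≤ ·) x z := by
  induction h1 generalizing z with
  | nil => exact h2
  | cons h _ ih =>
    cases h2 with
    | cons h' h2 => exact .cons (h.trans h') (ih h2)

theorem forall₂_le_antisymm {x y : List ℕ} (h1 : List.Forall₂ (· ≤ ·) x y)
    (h2 : List.Forall₂ (· ≤ ·) y x) : x = y := by
  induction h1 with
  | nil => rfl
  | cons h _ ih =>
    cases h2 with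
    | cons h' h2 => rw [le_antisymm h h', ih h2]

theorem forall₂_le_foldl_bump (js : List ℕ) (x : List ℕ) :
    List.Forall₂ (· ≤ ·) x (js.foldl bump x) := by
  induction js generalizing x with
  | nil => exact List.forall₂_refl x
  | cons j js ih => exact forall₂_le_trans (forall₂_le_bump x j) (ih _)

/-- Bumps never decrease an entry, so a later bump cannot undo an earlier one. -/
theorem foldl_bump_eq_self_iff {js x : List ℕ} :
    js.foldl bump x = x ↔ ∀ j ∈ js, bump x j = x := by
  induction js with
  | nil => simp
  | cons j js ih =>
    rw [List.forall_mem_cons, ← ih, List.foldl_cons]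
    constructor
    · intro h
      have h1 : bump x j = x := by
        refine (forall₂_le_antisymm (forall₂_le_bump x j) ?_).symm
        simpa only [h] using forall₂_le_foldl_bump js (bump x j)
      exact ⟨h1, by rwa [h1] at h⟩
    · rintro ⟨h1, h2⟩
      rwa [h1]

theorem bump_eq_self_iff {x : List ℕ} {j : ℕ} (hj : j + 1 < x.length) :
    bump x j = x ↔ ∀ (i : ℕ) (hi : i ≤ j), x[i] < x[j + 1] := by
  rw [List.ext_getElem_iff]
  simp only [length_bump, true_and]
  constructor
  · intro h i hi
    have := h i (by omega) (by omega)
    simp only [bump, List.getElem_mapIdx, List.getD_eq_getElem _ _ hj] at this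
    split_ifs at this <;> omega
  · intro h i h1 _
    simp only [bump, List.getElem_mapIdx, List.getD_eq_getElem _ _ hj]
    split_ifs with h'
    · exact absurd (h i h'.1) (by omega)
    · rfl

/-- A sequence is fixed by the modification if and only if each ascent top exceeds all the
entries before it. -/
theorem modify_eq_self_iff {x : List ℕ} :
    modify x = x ↔ ∀ (j : ℕ) (hj : j + 1 < x.length), x[j] < x[j + 1] →
      ∀ (i : ℕ) (hi : i ≤ j), x[i] < x[j + 1] := by
  have hmem : ∀ j, j ∈ ascents x ↔ ∃ hj : j + 1 < x.length, x[j] < x[j + 1] := by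
    intro j
    simp only [ascents, List.mem_filter, List.mem_range, decide_eq_true_eq]
    constructor
    · rintro ⟨h1, h2⟩
      have hj : j + 1 < x.length := by omega
      refine ⟨hj, ?_⟩
      rwa [List.getD_eq_getElem _ _ hj, List.getD_eq_getElem _ _ (by omega : j < x.length)] at h2
    · rintro ⟨hj, h⟩
      refine ⟨by omega, ?_⟩
      rwa [List.getD_eq_getElem _ _ hj, List.getD_eq_getElem _ _ (by omega : j < x.length)]
  rw [modify, foldl_bump_eq_self_iff]
  constructor
  · intro h j hj hlt
    exact (bump_eq_self_iff hj).1 (h j ((hmem j).2 ⟨hj, hlt⟩))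
  · intro h j hj
    obtain ⟨hj, hlt⟩ := (hmem j).1 hj
    exact (bump_eq_self_iff hj).2 (h j hj hlt)

/-- Only position `m` can be new. This converts a bound by the ascent tops up to and including an
entry into the bound that `IsAscentSequence` asks for. -/
theorem card_ascentTops_take_succ_le (x : List ℕ) (m : ℕ) :
    (ascentTops (x.take (m + 1))).card ≤ (ascentTops (x.take m)).card + 1 := by
  refine (Finset.card_le_card (t := insert m (ascentTops (x.take m))) ?_).trans
    (Finset.card_insert_le _ _)
  intro t ht
  simp only [ascentTops, Finset.mem_filter, Finset.mem_range, List.length_take,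
    Finset.mem_insert] at ht ⊢
  by_cases htm : t = m
  · exact Or.inl htm
  · refine Or.inr ⟨by omega, ht.2.imp_right fun h => ?_⟩
    have h1 : t < m := by omega
    have h2 : t < x.length := by omega
    simpa [List.getD_eq_getElem?_getD, List.getElem?_take, h1, show t < m + 1 by omega,
      show t - 1 < m by omega, show t - 1 < m + 1 by omega] using h

/-! ### The in-order sequence of a Fishburn tree -/

theorem length_inorderSeq (T : BinaryTree ℕ) : (inorderSeq T).length = (inorder T).length := by
  simp [inorderSeq]

theorem getElem_inorderSeq {T : BinaryTree ℕ} {i : ℕ} (hi : i < (inorderSeq T).length) :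
    (inorderSeq T)[i] = lbl T ((inorder T)[i]'(length_inorderSeq T ▸ hi)) := by
  simp [inorderSeq]

namespace IsFishburnTree

variable {T : BinaryTree ℕ}

/-- Climbing out of a left subtree strictly increases the label and ends at a node with a left
child; descending into a right subtree does not increase it and ends at a node that is not a
treetop. -/
theorem lbl_lt_succ_iff (hT : IsFishburnTree T) {i : ℕ} (h : i + 1 < (inorder T).length) :
    lbl T (inorder T)[i] < lbl T (inorder T)[i + 1] ↔ (inorder T)[i + 1] ∈ treetops T := by
  have hu := mem_inorder.1 (List.getElem_mem (l := inorder T) (n := i) (by omega))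
  rcases inorderSucc_getElem T h with ⟨n, hn⟩ | ⟨hl, n, hn⟩
  · rw [hn] at hu
    have hl := mem_vertices_of_append hu
    have hv := mem_vertices_of_cons hl
    refine iff_of_true ?_ (Or.inr ⟨hv, hl⟩)
    rw [hn]
    exact (lbl_append_le hT.isDecreasing _ _).trans_lt
      (lbl_left_lt hT.isStrictlyDecreasingLeft hv)
  · refine iff_of_false (not_lt.2 ?_) ?_
    · conv_lhs => rw [hn]
      exact (lbl_append_le hT.isDecreasing _ _).trans (lbl_cons_le hT.isDecreasing _ _)
    · rintro (h' | h')
      · exact Dir.noConfusion ((mem_diag_of_head? h').2 Dir.right (by rw [hn]; simp))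
      · exact h'.2 hl

theorem lbl_lt_of_mem_diag (hT : IsFishburnTree T) {i j : ℕ} (hi : i < (inorder T).length)
    (hj : j < (inorder T).length) (hij : i < j) (hd : (inorder T)[j] ∈ diag T) :
    lbl T (inorder T)[i] < lbl T (inorder T)[j] := by
  obtain ⟨s, hs⟩ := exists_append_of_index_lt hi hj hij hd
  rw [hs]
  exact (lbl_append_le hT.isDecreasing _ _).trans_lt
    (lbl_left_lt hT.isStrictlyDecreasingLeft hd.1)

theorem isStrictlyDecreasing_iff (hT : IsFishburnTree T) :
    IsStrictlyDecreasing T ↔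
      ∀ v, Dir.right :: v ∈ vertices T → lbl T (Dir.right :: v) < lbl T v :=
  ⟨fun h _ hv => lbl_right_lt h (mem_vertices_of_cons hv),
    isStrictlyDecreasing_of_lbl_right_lt hT.isDecreasing hT.isStrictlyDecreasingLeft
      fun _ hv => (hT.lbl_mem hv).1⟩

theorem isStrictlyDecreasing_iff_isPrimitiveSeq (hT : IsFishburnTree T) :
    IsStrictlyDecreasing T ↔ IsPrimitiveSeq (inorderSeq T) := by
  rw [hT.isStrictlyDecreasing_iff]
  constructor
  · intro h i hi
    have hi' : i + 1 < (inorder T).length := length_inorderSeq T ▸ hi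
    rw [getElem_inorderSeq, getElem_inorderSeq]
    have hv := mem_inorder.1 (List.getElem_mem hi')
    by_cases ht : (inorder T)[i + 1] ∈ treetops T
    · exact ((hT.lbl_lt_succ_iff hi').2 ht).ne
    -- The successor is not a treetop, so it lies at or below the right child of its predecessor.
    · refine (lt_of_le_of_lt ?_ (h (inorder T)[i] ?_)).ne'
      all_goals rcases inorderSucc_getElem T hi' with ⟨n, hn⟩ | ⟨hl, n, hn⟩
      · have hu := mem_inorder.1 (List.getElem_mem (l := inorder T) (n := i) (by omega))
        rw [hn] at hu
        exact absurd (Or.inr ⟨hv, mem_vertices_of_append hu⟩) ht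
      · rw [hn]
        exact lbl_append_le hT.isDecreasing _ _
      · have hu := mem_inorder.1 (List.getElem_mem (l := inorder T) (n := i) (by omega))
        rw [hn] at hu
        exact absurd (Or.inr ⟨hv, mem_vertices_of_append hu⟩) ht
      · rw [hn] at hv
        exact mem_vertices_of_append hv
  · intro h p hp
    refine lt_of_le_of_ne (lbl_cons_le hT.isDecreasing _ _) fun heq => ?_
    obtain ⟨j, hj, hj'⟩ := List.getElem_of_mem (mem_inorder.2 hp)
    obtain ⟨i, hi, hi'⟩ := List.getElem_of_mem (mem_inorder.2 (mem_vertices_of_cons hp))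
    have hij : i < j := index_lt_of_right hi hj (s := []) (by rw [hj', hi', List.nil_append])
    obtain ⟨j, rfl⟩ : ∃ m, j = m + 1 := ⟨j - 1, by omega⟩
    -- The label of the right child already occurred at `p`.
    have hnt : (inorder T)[j + 1] ∉ treetops T := by
      rw [← hT.2]
      rintro ⟨m, hm, hm1, hm2⟩
      obtain rfl : m = j + 1 := (nodup_inorder T).getElem_inj_iff.1 hm1
      exact hm2 i hij (by rw [hi', hj', heq])
    rcases inorderSucc_getElem T hj with ⟨n, hn⟩ | ⟨hl, n, hn⟩
    · have hu := mem_inorder.1 (List.getElem_mem (l := inorder T) (n := j) (by omega))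
      rw [hn] at hu
      exact hnt (Or.inr ⟨mem_inorder.1 (List.getElem_mem hj), mem_vertices_of_append hu⟩)
    · rw [hj'] at hn
      -- The address starts with a right turn, so `n = 0` and the predecessor is the parent.
      have hp' : p = (inorder T)[j] := by
        cases n with
        | zero => simpa using hn
        | succ n => simp [List.replicate_succ] at hn
      refine h j (by rwa [length_inorderSeq]) ?_
      rw [getElem_inorderSeq, getElem_inorderSeq, ← hp', hj', heq]

/-! ### Comb-shaped trees and self-modified sequences -/

theorem isCombShaped_iff_treetops_subset (T : BinaryTree ℕ) :
    IsCombShaped T ↔ treetops T ⊆ diag T := by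
  constructor
  · intro h v hv
    by_contra hd
    exact hd (h v (mem_vertices_of_mem_treetops hv) (left_ne_nil_of_mem_treetops hv hd))
  · intro h v hv hl
    exact h (Or.inr ⟨hv, hl⟩)

theorem isCombShaped_iff_modify_eq_self (hT : IsFishburnTree T) :
    IsCombShaped T ↔ modify (inorderSeq T) = inorderSeq T := by
  rw [isCombShaped_iff_treetops_subset, modify_eq_self_iff]
  constructor
  · intro h j hj hlt i hi
    have hj' : j + 1 < (inorder T).length := length_inorderSeq T ▸ hj
    rw [getElem_inorderSeq, getElem_inorderSeq] at hlt ⊢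
    exact hT.lbl_lt_of_mem_diag _ hj' (by omega) (h ((hT.lbl_lt_succ_iff hj').1 hlt))
  · intro h v hv
    by_contra hd
    have hv' := mem_vertices_of_mem_treetops hv
    -- Off the diagonal there is a right turn, at some `p`; this `p` precedes `v` and has at least
    -- its label.
    obtain ⟨s, p, rfl⟩ : ∃ s p, v = s ++ Dir.right :: p := by
      have : Dir.right ∈ v := by
        by_contra hr
        refine hd ⟨hv', fun d hdv => ?_⟩
        cases d with
        | left => rfl
        | right => exact absurd hdv hr
      exact List.append_of_mem this
    obtain ⟨j, hj, hj'⟩ := List.getElem_of_mem (mem_inorder.2 hv')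
    obtain ⟨i, hi, hi'⟩ := List.getElem_of_mem
      (mem_inorder.2 (mem_vertices_of_cons (mem_vertices_of_append hv')))
    have hij : i < j := index_lt_of_right hi hj (s := s) (by rw [hj', hi'])
    obtain ⟨j, rfl⟩ : ∃ m, j = m + 1 := ⟨j - 1, by omega⟩
    have hlt := (hT.lbl_lt_succ_iff hj).2 (by rwa [hj'])
    have := h j (by rwa [length_inorderSeq]) (by rwa [getElem_inorderSeq, getElem_inorderSeq]) i
      (by omega)
    rw [getElem_inorderSeq, getElem_inorderSeq, hi', hj'] at this
    exact this.not_ge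
      ((lbl_append_le hT.isDecreasing _ _).trans (lbl_cons_le hT.isDecreasing _ _))

/-- Each label up to `xᵢ` is carried by a treetop. It is on the diagonal, so if it came after
position `i` it would exceed `xᵢ`. Hence at least `xᵢ` ascent tops occur by position `i`. -/
theorem getElem_inorderSeq_le_card_ascentTops (hT : IsFishburnTree T) (hc : IsCombShaped T)
    {i : ℕ} (hi : i < (inorderSeq T).length) :
    (inorderSeq T)[i] ≤ (ascentTops ((inorderSeq T).take (i + 1))).card := by
  have hi' : i < (inorder T).length := length_inorderSeq T ▸ hi
  rw [isCombShaped_iff_treetops_subset] at hc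
  have hsub : Finset.Icc 1 (inorderSeq T)[i] ⊆
      (ascentTops ((inorderSeq T).take (i + 1))).image fun t => (inorderSeq T).getD t 0 := by
    intro a ha
    rw [Finset.mem_Icc, getElem_inorderSeq] at ha
    obtain ⟨v, hv, rfl⟩ := hT.exists_treetop_lbl_eq ha.1
      (ha.2.trans (hT.isDecreasing.lbl_le_treeMax _))
    obtain ⟨t, ht, rfl⟩ := List.getElem_of_mem (mem_inorder.2 (mem_vertices_of_mem_treetops hv))
    have hti : t ≤ i := by
      by_contra hlt
      exact ha.2.not_gt (hT.lbl_lt_of_mem_diag hi' ht (by omega) (hc hv))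
    have ht' : t < (inorderSeq T).length := by rwa [length_inorderSeq]
    refine Finset.mem_image.2 ⟨t, ?_, by
      rw [List.getD_eq_getElem _ _ ht', getElem_inorderSeq]⟩
    simp only [ascentTops, Finset.mem_filter, Finset.mem_range, List.length_take]
    refine ⟨by omega, ?_⟩
    cases t with
    | zero => exact Or.inl rfl
    | succ t =>
      right
      have h := (hT.lbl_lt_succ_iff ht).2 hv
      have hl : ((inorderSeq T).take (i + 1)).length = i + 1 := by
        rw [List.length_take]
        omega
      rw [Nat.add_sub_cancel, List.getD_eq_getElem _ _ (by omega),
        List.getD_eq_getElem _ _ (by omega), List.getElem_take, List.getElem_take,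
        getElem_inorderSeq, getElem_inorderSeq]
      exact h
  simpa using (Finset.card_le_card hsub).trans Finset.card_image_le

theorem isAscentSequence_inorderSeq (hT : IsFishburnTree T) (hc : IsCombShaped T) :
    IsAscentSequence (inorderSeq T) := by
  refine ⟨?_, fun h => ?_, fun i hi => ?_⟩
  · intro a ha
    obtain ⟨v, hv, rfl⟩ := List.mem_map.1 ha
    rw [length_inorderSeq, length_inorder]
    exact hT.1.1.2.2 ⟨v, mem_inorder.1 hv, rfl⟩
  · have h1 := hT.getElem_inorderSeq_le_card_ascentTops hc h
    -- A prefix of length one has at most one ascent top, so the first entry is at most `1`.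
    have h2 := card_ascentTops_take_succ_le (inorderSeq T) 0
    have h3 : (ascentTops ((inorderSeq T).take 0)).card = 0 := by simp [ascentTops]
    have h4 := (hT.lbl_mem (mem_inorder.1 (List.getElem_mem (length_inorderSeq T ▸ h)))).1
    rw [← getElem_inorderSeq h] at h4
    omega
  · exact (hT.getElem_inorderSeq_le_card_ascentTops hc hi).trans
      (card_ascentTops_take_succ_le _ _)

theorem isCombShaped_iff_isSelfModified (hT : IsFishburnTree T) :
    IsCombShaped T ↔ IsSelfModified (inorderSeq T) := by
  constructor
  · intro h
    exact ⟨_, hT.isAscentSequence_inorderSeq h, hT.isCombShaped_iff_modify_eq_self.1 h, rfl⟩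
  · rintro ⟨y, -, h, rfl⟩
    exact hT.isCombShaped_iff_modify_eq_self.2 h

/-! ### The Fishburn matrix of a Fishburn tree -/

theorem fishburnMatrix_le_one_iff (hT : IsFishburnTree T) :
    (∀ i j, fishburnMatrix T i j = 0 ∨ fishburnMatrix T i j = 1) ↔
      ∀ u ∈ vertices T, ∀ v ∈ vertices T, pathIndex T u = pathIndex T v → lbl T u = lbl T v →
        u = v := by
  have h01 : ∀ n : ℕ, n = 0 ∨ n = 1 ↔ n ≤ 1 := fun n => by omega
  simp only [h01, fishburnMatrix_le_one]
  constructor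
  · intro h u hu v hv hb hl
    have h1 := hT.pathIndex_mem hu
    have h2 := hT.lbl_mem hu
    refine h ⟨pathIndex T u - 1, by omega⟩ ⟨lbl T u - 1, by omega⟩ u hu v hv ?_ ?_ ?_ ?_ <;>
      simp only <;> omega
  · intro h i j u hu v hv h1 h2 h3 h4
    exact h u hu v hv (h1.trans h3.symm) (h2.trans h4.symm)

theorem isStrictlyDecreasing_iff_injective (hT : IsFishburnTree T) :
    IsStrictlyDecreasing T ↔
      ∀ u ∈ vertices T, ∀ v ∈ vertices T, pathIndex T u = pathIndex T v → lbl T u = lbl T v →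
        u = v := by
  rw [hT.isStrictlyDecreasing_iff]
  constructor
  · intro h
    have hlt : ∀ (w : Address) (m n : ℕ), m < n → List.replicate n Dir.right ++ w ∈ vertices T →
        lbl T (List.replicate n Dir.right ++ w) < lbl T (List.replicate m Dir.right ++ w) := by
      intro w m n hmn
      induction n, hmn using Nat.le_induction with
      | base =>
        intro hv
        rw [List.replicate_succ, List.cons_append] at hv ⊢
        exact h _ hv
      | succ n _ ih =>
        intro hv
        rw [List.replicate_succ, List.cons_append] at hv ⊢
        exact (h _ hv).trans (ih (mem_vertices_of_cons hv))
    intro u hu v hv hb hl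
    have htop := hT.pathTop_eq_of_pathIndex_eq hu hv hb
    obtain ⟨m, hm⟩ := exists_eq_append_pathTop u
    obtain ⟨n, hn⟩ := exists_eq_append_pathTop v
    rw [← htop] at hn
    generalize pathTop u = w at hm hn
    subst hm hn
    rcases lt_trichotomy m n with hmn | rfl | hmn
    · exact absurd hl (hlt _ _ _ hmn hv).ne'
    · rfl
    · exact absurd hl (hlt _ _ _ hmn hu).ne
  · intro h v hv
    refine lt_of_le_of_ne (lbl_cons_le hT.isDecreasing _ _) fun heq => ?_
    have hb : pathIndex T (Dir.right :: v) = pathIndex T v := by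
      have htop : pathTop (Dir.right :: v) = pathTop v := by simp [pathTop]
      rw [pathIndex, pathIndex, pathNode, pathNode, htop]
    simpa using congrArg List.length (h _ hv v (mem_vertices_of_cons hv) hb heq)

theorem fishburnMatrix_diag_pos_iff (T : BinaryTree ℕ) :
    (∀ i, 0 < fishburnMatrix T i i) ↔
      ∀ i, 1 ≤ i → i ≤ treeMax T → ∃ u ∈ vertices T, pathIndex T u = i ∧ lbl T u = i := by
  simp only [fishburnMatrix_pos]
  constructor
  · intro h i h1 h2
    obtain ⟨u, hu, h3, h4⟩ := h ⟨i - 1, by omega⟩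
    exact ⟨u, hu, by simp only at h3; omega, by simp only at h4; omega⟩
  · intro h i
    exact h (i + 1) (by omega) (by omega)

theorem isCombShaped_iff_exists (hT : IsFishburnTree T) :
    IsCombShaped T ↔
      ∀ i, 1 ≤ i → i ≤ treeMax T → ∃ u ∈ vertices T, pathIndex T u = i ∧ lbl T u = i := by
  rw [isCombShaped_iff_treetops_subset]
  constructor
  · intro h i h1 h2
    obtain ⟨v, hv, rfl⟩ := hT.exists_treetop_lbl_eq h1 h2
    have hd := h hv
    exact ⟨v, hd.1, by rw [pathIndex, pathNode_of_mem_diag hd], rfl⟩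
  · intro h v hv
    by_contra hd
    have hv' := mem_vertices_of_mem_treetops hv
    obtain ⟨u, hu, h1, h2⟩ := h _ (hT.lbl_mem hv').1 (hT.lbl_mem hv').2
    have hl : Dir.left :: v ∈ vertices T := left_ne_nil_of_mem_treetops hv hd
    have hb : pathIndex T (Dir.left :: v) = lbl T v := by rw [pathIndex, pathNode_left hl hd]
    have htop := hT.pathTop_eq_of_pathIndex_eq hu hl (h1.trans hb.symm)
    obtain ⟨n, hn⟩ := exists_eq_append_pathTop u
    rw [htop, show pathTop (Dir.left :: v) = Dir.left :: v by simp [pathTop]] at hn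
    have h3 := lbl_append_le hT.isDecreasing (List.replicate n Dir.right) (Dir.left :: v)
    rw [← hn, h2] at h3
    exact h3.not_gt (lbl_left_lt hT.isStrictlyDecreasingLeft hv')

end IsFishburnTree

/-! ### The poset of a Fishburn tree -/

namespace FishburnTree

variable {T : FishburnTree}

theorem lt_iff {u v : T.Poset} : u < v ↔ pathIndex T.tree u.1 < lbl T.tree v.1 := Iff.rfl

/-- If `ℓ(u) < ℓ(v)`, a node `w` with `b(w) = ℓ(u)` is below `v` but not below `u`. `Ioi_eq_iff` is
dual, with `ℓ(w)` equal to the larger value of `b`. -/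
theorem Iio_eq_iff {u v : T.Poset} :
    Set.Iio u = Set.Iio v ↔ lbl T.tree u.1 = lbl T.tree v.1 := by
  constructor
  · intro h
    have key : ∀ u v : T.Poset, Set.Iio u = Set.Iio v →
        ¬ lbl T.tree u.1 < lbl T.tree v.1 := by
      intro u v h hlt
      obtain ⟨w, hw, hwi⟩ := T.isFishburn.exists_pathIndex_eq (T.isFishburn.lbl_mem u.2).1
        (T.isFishburn.lbl_mem u.2).2
      have h1 : (⟨w, hw⟩ : T.Poset) ∈ Set.Iio v := lt_iff.2 (hwi.trans_lt hlt)
      rw [← h] at h1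
      exact (lt_iff.1 h1).ne hwi
    exact le_antisymm (not_lt.1 (key v u h.symm)) (not_lt.1 (key u v h))
  · intro h
    ext w
    simp only [Set.mem_Iio, lt_iff, h]

theorem Ioi_eq_iff {u v : T.Poset} :
    Set.Ioi u = Set.Ioi v ↔ pathIndex T.tree u.1 = pathIndex T.tree v.1 := by
  constructor
  · intro h
    have key : ∀ u v : T.Poset, Set.Ioi u = Set.Ioi v →
        ¬ pathIndex T.tree u.1 < pathIndex T.tree v.1 := by
      intro u v h hlt
      obtain ⟨w, hw, hwi⟩ := T.isFishburn.exists_lbl_eq (T.isFishburn.pathIndex_mem v.2).1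
        (T.isFishburn.pathIndex_mem v.2).2
      have h1 : (⟨w, hw⟩ : T.Poset) ∈ Set.Ioi u := lt_iff.2 (hlt.trans_eq hwi.symm)
      rw [h] at h1
      exact (lt_iff.1 h1).ne hwi.symm
    exact le_antisymm (not_lt.1 (key v u h.symm)) (not_lt.1 (key u v h))
  · intro h
    ext w
    simp only [Set.mem_Ioi, lt_iff, h]

theorem isPrimitivePoset_iff (T : FishburnTree) :
    IsPrimitivePoset T.Poset ↔
      ∀ u ∈ vertices T.tree, ∀ v ∈ vertices T.tree,
        pathIndex T.tree u = pathIndex T.tree v → lbl T.tree u = lbl T.tree v → u = v := by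
  constructor
  · intro h u hu v hv hb hl
    by_contra hne
    exact h ⟨u, hu⟩ ⟨v, hv⟩ (fun h' => hne (congrArg Subtype.val h'))
      ⟨Iio_eq_iff.2 hl, Ioi_eq_iff.2 hb⟩
  · rintro h u v hne ⟨h1, h2⟩
    exact hne (Subtype.ext (h u.1 u.2 v.1 v.2 (Ioi_eq_iff.1 h2) (Iio_eq_iff.1 h1)))

theorem numLevels_eq (T : FishburnTree) : numLevels T.Poset = treeMax T.tree := by
  have himage : (fun i => {w : T.Poset | pathIndex T.tree w.1 < i}) ''
      Set.Icc 1 (treeMax T.tree) = Set.range fun u : T.Poset => Set.Iio u := by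
    rw [← T.isFishburn.lbl_image, Set.image_image]
    ext s
    constructor
    · rintro ⟨v, hv, rfl⟩
      exact ⟨⟨v, hv⟩, rfl⟩
    · rintro ⟨v, rfl⟩
      exact ⟨v.1, v.2, rfl⟩
  rw [numLevels, ← himage, Set.InjOn.ncard_image]
  · rw [← Finset.coe_Icc, Set.ncard_coe_finset]
    simp
  · intro i hi j hj h
    obtain ⟨u, hu, rfl⟩ := T.isFishburn.exists_lbl_eq hi.1 hi.2
    obtain ⟨v, hv, rfl⟩ := T.isFishburn.exists_lbl_eq hj.1 hj.2
    exact (Iio_eq_iff (u := (⟨u, hu⟩ : T.Poset)) (v := ⟨v, hv⟩)).1 h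

/-- Labels strictly increase along a chain, since `u < v` gives `ℓ(u) ≤ b(u) < ℓ(v)`. -/
theorem injOn_lbl_of_isChain {c : Set T.Poset} (hc : IsChain (· ≤ ·) c) :
    Set.InjOn (fun u : T.Poset => lbl T.tree u.1) c := by
  intro u hu v hv (h : lbl T.tree u.1 = lbl T.tree v.1)
  by_contra hne
  have h1 := lbl_le_pathIndex T.isFishburn.isDecreasing u.1
  have h2 := lbl_le_pathIndex T.isFishburn.isDecreasing v.1
  rcases hc hu hv hne with h' | h'
  · have := lt_iff.1 (lt_of_le_of_ne h' hne)
    omega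
  · have := lt_iff.1 (lt_of_le_of_ne h' (Ne.symm hne))
    omega

theorem hasChainOfMaximumLength_iff (T : FishburnTree) :
    HasChainOfMaximumLength T.Poset ↔ ∀ i, 1 ≤ i → i ≤ treeMax T.tree →
      ∃ u ∈ vertices T.tree, pathIndex T.tree u = i ∧ lbl T.tree u = i := by
  classical
  unfold HasChainOfMaximumLength
  rw [numLevels_eq]
  constructor
  · rintro ⟨c, hc, hcard⟩ i h1 h2
    have himage : c.image (fun u => lbl T.tree u.1) = Finset.Icc 1 (treeMax T.tree) := by
      refine Finset.eq_of_subset_of_card_le ?_ ?_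
      · intro a ha
        obtain ⟨u, -, rfl⟩ := Finset.mem_image.1 ha
        exact Finset.mem_Icc.2 (T.isFishburn.lbl_mem u.2)
      · rw [Finset.card_image_of_injOn (injOn_lbl_of_isChain hc), hcard]
        simp
    have hex : ∀ i, 1 ≤ i → i ≤ treeMax T.tree → ∃ u ∈ c, lbl T.tree u.1 = i := by
      intro i h1 h2
      have : i ∈ c.image (fun u => lbl T.tree u.1) := himage ▸ Finset.mem_Icc.2 ⟨h1, h2⟩
      exact Finset.mem_image.1 this
    obtain ⟨u, hu, hui⟩ := hex i h1 h2
    refine ⟨u.1, u.2, ?_, hui⟩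
    have hle := lbl_le_pathIndex T.isFishburn.isDecreasing u.1
    have hmax := (T.isFishburn.pathIndex_mem u.2).2
    -- For the top label, `ℓ(u) ≤ b(u) ≤ k` forces equality; otherwise the chain element labeled `i
    -- + 1` lies above `u`, so `b(u) < i + 1`.
    by_cases hi : i = treeMax T.tree
    · omega
    · obtain ⟨v, hv, hvi⟩ := hex (i + 1) (by omega) (by omega)
      have hne : u ≠ v := by
        rintro rfl
        omega
      have hle' := lbl_le_pathIndex T.isFishburn.isDecreasing v.1
      rcases hc hu hv hne with h' | h'
      · have := lt_iff.1 (lt_of_le_of_ne h' hne)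
        omega
      · have := lt_iff.1 (lt_of_le_of_ne h' (Ne.symm hne))
        omega
  · intro h
    choose! f hf hb hl using h
    let g : {i // i ∈ Finset.Icc 1 (treeMax T.tree)} → T.Poset := fun i =>
      ⟨f i.1, hf i.1 (Finset.mem_Icc.1 i.2).1 (Finset.mem_Icc.1 i.2).2⟩
    -- On nodes with `b = ℓ` the order of `Q` is the order of the labels.
    have hlt : ∀ i j, i < j → g i < g j := by
      intro i j hij
      have hi := Finset.mem_Icc.1 i.2
      have hj := Finset.mem_Icc.1 j.2
      refine lt_iff.2 ?_
      change pathIndex T.tree (f i.1) < lbl T.tree (f j.1)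
      rw [hb _ hi.1 hi.2, hl _ hj.1 hj.2]
      exact hij
    have hmono : StrictMono g := hlt
    refine ⟨Finset.univ.image g, ?_, ?_⟩
    · rw [Finset.coe_image, Finset.coe_univ, Set.image_univ]
      exact hmono.monotone.isChain_range
    · rw [Finset.card_image_of_injective _ hmono.injective]
      simp

end FishburnTree

end Fishburn

theorem mainTheorem7 (T : Fishburn.FishburnTree) :
    [Fishburn.IsStrictlyDecreasing T.tree,
      Fishburn.IsPrimitiveSeq (Fishburn.inorderSeq T.tree),
      ∀ i j, Fishburn.fishburnMatrix T.tree i j = 0 ∨ Fishburn.fishburnMatrix T.tree i j = 1,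
      Fishburn.IsPrimitivePoset T.Poset].TFAE ∧
    [Fishburn.IsCombShaped T.tree,
      Fishburn.IsSelfModified (Fishburn.inorderSeq T.tree),
      ∀ i, 0 < Fishburn.fishburnMatrix T.tree i i,
      Fishburn.HasChainOfMaximumLength T.Poset].TFAE := by
  have hT := T.isFishburn
  constructor
  · tfae_have 1 ↔ 2 := hT.isStrictlyDecreasing_iff_isPrimitiveSeq
    tfae_have 1 ↔ 3 :=
      hT.isStrictlyDecreasing_iff_injective.trans hT.fishburnMatrix_le_one_iff.symm
    tfae_have 1 ↔ 4 :=
      hT.isStrictlyDecreasing_iff_injective.trans T.isPrimitivePoset_iff.symm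
    tfae_finish
  · tfae_have 1 ↔ 2 := hT.isCombShaped_iff_isSelfModified
    tfae_have 1 ↔ 3 := hT.isCombShaped_iff_exists.trans (Fishburn.IsFishburnTree.fishburnMatrix_diag_pos_iff _).symm
    tfae_have 1 ↔ 4 := hT.isCombShaped_iff_exists.trans T.hasChainOfMaximumLength_iff.symm
    tfae_finish
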